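/- A halved monotone triangle with $n\ge 1$ rows is an array of integers $(a_{i,j})_{1\le i\le n,\ 1\le j\le\lceil i/2\rceil}$ such that $a_{i+1,j}\le a_{i,j}$, $a_{i,j}\le a_{i+1,j+1}$ and $a_{i,j}<a_{i,j+1}$ whenever the entries involved exist; its bottom row is $(a_{n,1},\ldots,a_{n,\lceil n/2\rceil})$. For a variable $k$ let $E_k$ be the shift operator $E_k p(k)=p(k+1)$ on polynomials, $E_k^{-1}$ its inverse, and $\operatorname{id}$ the identity operator. **Theorem.** Let $n\ge 1$ and let $x$ and $k_1<k_2<\cdots<k_{\lceil n/2\rceil}\le x$ be integers. The number of halved monotone triangles with $n$ rows, with no entry exceeding $x$ and with bottom row $(k_1,\ldots,k_{\lceil n/2\rceil})$ is finite. If $n$ is odd, it equals $$\left(\prod_{1\le p<q\le (n+1)/2} E_{k_p}\left(E_{k_p}^{-1}+E_{k_q}^{-1}-\operatorname{id}\right)\left(E_{k_p}^{-1}+E_{k_q}-\operatorname{id}\right)\right)\prod_{1\le i<j\le (n+1)/2}\frac{(k_j-k_i)(2x+1-k_i-k_j)}{(j-i)(j+i-1)},$$ and if $n$ is even, it equals $$\left(\prod_{1\le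 p<q\le n/2} E_{k_p}\left(E_{k_p}^{-1}+E_{k_q}^{-1}-\operatorname{id}\right)\left(E_{k_p}^{-1}+E_{k_q}-\operatorname{id}\right)\right)\left(\prod_{1\le i<j\le n/2}\frac{(k_j-k_i)(2x+2-k_i-k_j)}{(j-i)(j+i)}\ \prod_{i=1}^{n/2}\frac{x+1-k_i}{i}\right).$$ Here the product of operators is composition (the operators commute, so the order is irrelevant); the operators act on the displayed product regarded as a polynomial in the variables $k_1,\ldots,k_{\lceil n/2\rceil}$, and the result is then evaluated at the given integers. -/

import Mathlib

/-- Positions `(i, j)` of a halved triangular array with `n` rows: `1 ≤ i ≤ n` and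
`1 ≤ j ≤ ⌈i / 2⌉` (in `ℕ`, `⌈i / 2⌉ = (i + 1) / 2`). -/
abbrev HalvedIndex (n : ℕ) : Type :=
  {p : ℕ × ℕ // (1 ≤ p.1 ∧ p.1 ≤ n) ∧ (1 ≤ p.2 ∧ p.2 ≤ (p.1 + 1) / 2)}

/-- The row number `i` of a position `(i, j)`. -/
abbrev HalvedIndex.row {n : ℕ} (s : HalvedIndex n) : ℕ := s.1.1

/-- The column number `j` of a position `(i, j)`. -/
abbrev HalvedIndex.col {n : ℕ} (s : HalvedIndex n) : ℕ := s.1.2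

/-- Halved monotone triangles with `n` rows: the integer arrays with `a (i+1, j) ≤ a (i, j)`,
`a (i, j) ≤ a (i+1, j+1)` and `a (i, j) < a (i, j+1)` whenever both positions exist. -/
structure IsHalvedMonotoneTriangle {n : ℕ} (a : HalvedIndex n → ℤ) : Prop where
  northeast : ∀ s t : HalvedIndex n, t.row = s.row + 1 → t.col = s.col → a t ≤ a s
  southeast : ∀ s t : HalvedIndex n, t.row = s.row + 1 → t.col = s.col + 1 → a s ≤ a t
  strict_row : ∀ s t : HalvedIndex n, t.row = s.row → t.col = s.col + 1 → a s < a t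

/-- The halved monotone triangles with `n` rows, no entry exceeding `x`, and bottom row `k`.
The mathematical `k_j` is `k (j - 1)` here, since `Fin` counts from `0`. -/
def halvedMonotoneTriangles (n : ℕ) (x : ℤ) (k : Fin ((n + 1) / 2) → ℤ) :
    Set (HalvedIndex n → ℤ) :=
  {a | IsHalvedMonotoneTriangle a ∧ (∀ s, a s ≤ x) ∧
    ∀ (j : Fin ((n + 1) / 2)) (s : HalvedIndex n), s.row = n → s.col = (j : ℕ) + 1 → a s = k j}

/-- The substitution `k_i ↦ k_i + c` on polynomials in `k_1, …, k_m` over `ℚ`. -/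
noncomputable def translateVar {m : ℕ} (i : Fin m) (c : ℚ) :
    Module.End ℚ (MvPolynomial (Fin m) ℚ) :=
  (MvPolynomial.aeval
    (Function.update MvPolynomial.X i (MvPolynomial.X i + MvPolynomial.C c)) :
      MvPolynomial (Fin m) ℚ →ₐ[ℚ] MvPolynomial (Fin m) ℚ).toLinearMap

theorem translateVar_mul_neg {m : ℕ} (i : Fin m) (c d : ℚ) (h : c + d = 0) :
    translateVar i c * translateVar i d = 1 := by
  unfold translateVar
  rw [Module.End.mul_eq_comp, ← AlgHom.comp_toLinearMap, Module.End.one_eq_id,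
    ← AlgHom.toLinearMap_id]
  congr 1
  ext1 j
  by_cases hj : j = i
  · subst hj
    simp [add_assoc, ← MvPolynomial.C_add, h]
  · simp [hj]

theorem translateVar_commute {m : ℕ} (i j : Fin m) (c d : ℚ) :
    Commute (translateVar i c) (translateVar j d) := by
  unfold translateVar Commute SemiconjBy
  rw [Module.End.mul_eq_comp, Module.End.mul_eq_comp, ← AlgHom.comp_toLinearMap,
    ← AlgHom.comp_toLinearMap]
  congr 1
  ext1 l
  by_cases hi : l = i <;> by_cases hj : l = j
  · subst hi
    subst hj
    simp [← MvPolynomial.algebraMap_eq, add_right_comm]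
  · subst hi
    simp [← MvPolynomial.algebraMap_eq, hj]
  · subst hj
    simp [← MvPolynomial.algebraMap_eq, hi]
  · simp [hi, hj]

/-- The shift operator `E_{k_i}`, `(E_{k_i} P)(…, k_i, …) = P(…, k_i + 1, …)`, as an invertible
linear operator on polynomials; multiplication of operators is composition. -/
noncomputable def shiftOp {m : ℕ} (i : Fin m) :
    (Module.End ℚ (MvPolynomial (Fin m) ℚ))ˣ where
  val := translateVar i 1
  inv := translateVar i (-1)
  val_inv := translateVar_mul_neg i 1 (-1) (by norm_num)
  inv_val := translateVar_mul_neg i (-1) 1 (by norm_num)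

/-- `E_{k_p} (E_{k_p}⁻¹ + E_{k_q}⁻¹ - id) (E_{k_p}⁻¹ + E_{k_q} - id)`. -/
noncomputable def pairOp {m : ℕ} (p q : Fin m) : Module.End ℚ (MvPolynomial (Fin m) ℚ) :=
  ((shiftOp p : (Module.End ℚ (MvPolynomial (Fin m) ℚ))ˣ) :
      Module.End ℚ (MvPolynomial (Fin m) ℚ)) *
    (((shiftOp p)⁻¹ : (Module.End ℚ (MvPolynomial (Fin m) ℚ))ˣ) +
      ((shiftOp q)⁻¹ : (Module.End ℚ (MvPolynomial (Fin m) ℚ))ˣ) - 1) *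
    (((shiftOp p)⁻¹ : (Module.End ℚ (MvPolynomial (Fin m) ℚ))ˣ) +
      (shiftOp q : (Module.End ℚ (MvPolynomial (Fin m) ℚ))ˣ) - 1)

theorem pairOp_commute {m : ℕ} (p q r s : Fin m) : Commute (pairOp p q) (pairOp r s) := by
  have key : ∀ (T : Module.End ℚ (MvPolynomial (Fin m) ℚ)),
      (∀ i c, Commute T (translateVar i c)) → ∀ a b, Commute T (pairOp a b) := by
    intro T hT a b
    exact ((hT a 1).mul_right (((hT a (-1)).add_right (hT b (-1))).sub_right
      (Commute.one_right T))).mul_right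
        (((hT a (-1)).add_right (hT b 1)).sub_right (Commute.one_right T))
  exact key _ (fun i c => (key _ (fun j d => translateVar_commute i j c d) p q).symm) r s

/-- The index pairs `p < q`. -/
def ltPairs (m : ℕ) : Finset (Fin m × Fin m) :=
  Finset.univ.filter fun pq => pq.1 < pq.2

/-- The composition of the operators `pairOp p q` over all `p < q`, in any order. -/
noncomputable def totalOp (m : ℕ) : Module.End ℚ (MvPolynomial (Fin m) ℚ) :=
  (ltPairs m).noncommProd (fun pq => pairOp pq.1 pq.2)
    (fun _ _ _ _ _ => pairOp_commute _ _ _ _)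

/-- The one-based number of an index, as a rational. -/
def oneBased {m : ℕ} (i : Fin m) : ℚ := (i : ℕ) + 1

open MvPolynomial in
/-- `∏_{i < j} (k_j - k_i) (2x + 1 - k_i - k_j) / ((j - i) (j + i - 1))`. -/
noncomputable def oddPoly (m : ℕ) (x : ℤ) : MvPolynomial (Fin m) ℚ :=
  ∏ ij ∈ ltPairs m,
    (X ij.2 - X ij.1) * (C (2 * (x : ℚ) + 1) - X ij.1 - X ij.2) *
      C (1 / ((oneBased ij.2 - oneBased ij.1) * (oneBased ij.2 + oneBased ij.1 - 1)))

open MvPolynomial in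
/-- `∏_{i < j} (k_j - k_i) (2x + 2 - k_i - k_j) / ((j - i) (j + i)) * ∏_i (x + 1 - k_i) / i`. -/
noncomputable def evenPoly (m : ℕ) (x : ℤ) : MvPolynomial (Fin m) ℚ :=
  (∏ ij ∈ ltPairs m,
    (X ij.2 - X ij.1) * (C (2 * (x : ℚ) + 2) - X ij.1 - X ij.2) *
      C (1 / ((oneBased ij.2 - oneBased ij.1) * (oneBased ij.2 + oneBased ij.1)))) *
  ∏ i : Fin m, (C ((x : ℚ) + 1) - X i) * C (1 / oneBased i)

/-! Deleting the bottom row `k` leaves a triangle whose bottom row `l` is strictly increasing and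
interlaces `k` if the number of rows was odd, or `k` followed by `x` if it was even
(`truncate_image`). It therefore suffices that the claimed formulas satisfy these two summation
recursions. Both formulas have the form T D, where T is the total operator and D = det (g_a(k_b))
with `oddRow` or `evenRow` as the functions g_a. The products in the theorem are these determinants
because g_a is, up to row and column factors, a monic polynomial of degree a in a fixed quadratic
function of k_b (`det_prod_add`).

The obstacle is the strictness of `l`. As D is alternating and (1 - E_j + E_i E_j) T is symmetric in
neighbouring i, j, the function J = T D satisfies J(c+1, c+1) - J(c, c+1) + J(c, c) = 0 in
neighbouring coordinates (`IsAlternating.vanishesOnDiagonals`). This is the correction that makes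
the sum of the mixed difference of J over strict interlacing rows telescope to an alternating sum
over deletions of one entry (`sum_interlacing_diff`). Since T commutes with differences,
antidifferences of the g_a are all that is needed.

For an odd number of rows, the alternating sum is the Laplace expansion along a row of ones, because
deleting a variable from T leaves a smaller T and a shift (`mapDomainAlgHom_succAbove_totalElt`).
For an even number, T is invariant under inverting the last shift and `evenRow` is odd about `x +
1`, which kills every term except the one that skips `x`
(`shiftAction_totalElt_eq_zero_of_odd_last`). Encoding operators in a group algebra turns such
substitutions of shifts into algebra homomorphisms. -/

/-! ### Shift operators as a representation of a group algebra -/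

/-- The group algebra of `M` acting on functions `M → ℚ`, with `v` acting as the shift by `v`. -/
noncomputable def shiftAction (M : Type*) [AddCommGroup M] :
    AddMonoidAlgebra ℚ M →ₐ[ℚ] Module.End ℚ (M → ℚ) :=
  AddMonoidAlgebra.lift ℚ (Module.End ℚ (M → ℚ)) M
    { toFun := fun v => LinearMap.funLeft ℚ ℚ (fun k => k + v.toAdd)
      map_one' := by
        ext f k
        simp [LinearMap.funLeft]
      map_mul' := fun v w => by
        ext f k
        simp [LinearMap.funLeft, add_assoc] }

section ShiftAction

variable {M N : Type*} [AddCommGroup M] [AddCommGroup N]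

theorem shiftAction_single (v : M) (c : ℚ) (f : M → ℚ) (k : M) :
    shiftAction M (AddMonoidAlgebra.single v c) f k = c * f (k + v) := by
  simp [shiftAction, LinearMap.funLeft]

/-- A map that is affine over `φ` intertwines the shift actions. -/
theorem shiftAction_comp (φ : M →+ N) (α : M → N) (h : ∀ k v, α (k + v) = α k + φ v)
    (a : AddMonoidAlgebra ℚ M) (f : N → ℚ) (k : M) :
    shiftAction M a (fun t => f (α t)) k =
      shiftAction N (AddMonoidAlgebra.mapDomainAlgHom ℚ ℚ φ a) f (α k) := by
  induction a using AddMonoidAlgebra.induction_linear with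
  | zero => simp
  | add a b ha hb => simp only [map_add, LinearMap.add_apply, Pi.add_apply, ha, hb]
  | single v c => simp [shiftAction_single, h]

/-- The group element `v` in the group algebra. -/
noncomputable def shiftElt (v : M) : AddMonoidAlgebra ℚ M := AddMonoidAlgebra.single v 1

theorem shiftElt_add (v w : M) : shiftElt (v + w) = shiftElt v * shiftElt w := by
  simp [shiftElt, AddMonoidAlgebra.single_mul_single]

theorem shiftElt_zero : shiftElt (0 : M) = 1 := rfl

theorem shiftElt_mul_neg (v : M) : shiftElt v * shiftElt (-v) = 1 := by
  rw [← shiftElt_add, add_neg_cancel, shiftElt_zero]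

theorem shiftAction_shiftElt (v : M) (f : M → ℚ) (k : M) :
    shiftAction M (shiftElt v) f k = f (k + v) := by
  simp [shiftElt, shiftAction_single]

theorem mapDomainAlgHom_shiftElt (φ : M →+ N) (v : M) :
    AddMonoidAlgebra.mapDomainAlgHom ℚ ℚ φ (shiftElt v) = shiftElt (φ v) := by
  simp [shiftElt]

/-- The group algebra element representing the operator `pairOp`. -/
noncomputable def pairElt (v w : M) : AddMonoidAlgebra ℚ M :=
  shiftElt v * (shiftElt (-v) + shiftElt (-w) - 1) * (shiftElt (-v) + shiftElt w - 1)

theorem mapDomainAlgHom_pairElt (φ : M →+ N) (v w : M) :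
    AddMonoidAlgebra.mapDomainAlgHom ℚ ℚ φ (pairElt v w) = pairElt (φ v) (φ w) := by
  simp only [pairElt, map_mul, map_add, map_sub, map_one, mapDomainAlgHom_shiftElt, map_neg]

/-- This and `pairElt_zero_right` tell what remains of a pair when the operator acts on a function
independent of one of the two variables. -/
theorem pairElt_zero_left (w : M) : pairElt 0 w = 1 := by
  have h := shiftElt_mul_neg w
  simp only [pairElt, neg_zero, shiftElt_zero]
  linear_combination h

theorem pairElt_zero_right (v : M) : pairElt v 0 = shiftElt (-v) := by
  have h := shiftElt_mul_neg v
  simp only [pairElt, neg_zero, shiftElt_zero]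
  linear_combination shiftElt (-v) * h

theorem pairElt_neg_right (v w : M) : pairElt v (-w) = pairElt v w := by
  simp only [pairElt, neg_neg]
  ring

/-- The element `1 - E_w + E_v E_w`, which makes `pairElt v w` symmetric. -/
noncomputable def diagElt (v w : M) : AddMonoidAlgebra ℚ M :=
  1 - shiftElt w + shiftElt v * shiftElt w

theorem diagElt_mul_pairElt_comm (v w : M) :
    diagElt v w * pairElt v w = diagElt w v * pairElt w v := by
  have hv := shiftElt_mul_neg v
  have hw := shiftElt_mul_neg w
  -- The outer factors of `pairElt a b` multiply to `diagElt b a`. Hence both sides are the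
  -- symmetric expression `(E_v⁻¹ + E_w⁻¹ - 1) * diagElt v w * diagElt w v`.
  have e : ∀ a b : M, shiftElt a * shiftElt (-a) = 1 →
      pairElt a b = (shiftElt (-a) + shiftElt (-b) - 1) * diagElt b a := by
    intro a b h
    simp only [pairElt, diagElt]
    linear_combination (shiftElt (-a) + shiftElt (-b) - 1) * h
  rw [e v w hv, e w v hw]
  ring

end ShiftAction

/-! ### The total operator -/

/-- The standard basis vector of `ℤ ^ m`. -/
abbrev unitVec {m : ℕ} (i : Fin m) : Fin m → ℤ := Pi.single i 1

/-- The group algebra element representing `totalOp`. -/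
noncomputable def totalElt (m : ℕ) : AddMonoidAlgebra ℚ (Fin m → ℤ) :=
  ∏ pq ∈ ltPairs m, pairElt (unitVec pq.1) (unitVec pq.2)

theorem prod_ltPairs {m : ℕ} {R : Type*} [CommMonoid R] (f : Fin m → Fin m → R) :
    ∏ pq ∈ ltPairs m, f pq.1 pq.2 = ∏ p, ∏ q, if p < q then f p q else 1 := by
  rw [ltPairs, Finset.prod_filter, Fintype.prod_prod_type]

/-- Values of a polynomial at integer points. -/
noncomputable def evalInt {m : ℕ} (P : MvPolynomial (Fin m) ℚ) (k : Fin m → ℤ) : ℚ :=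
  MvPolynomial.eval (fun i => (k i : ℚ)) P

/-- `T` acts on the integer values of polynomials like the group algebra element `a`. -/
def Represents {m : ℕ} (T : Module.End ℚ (MvPolynomial (Fin m) ℚ))
    (a : AddMonoidAlgebra ℚ (Fin m → ℤ)) : Prop :=
  ∀ P, evalInt (T P) = shiftAction _ a (evalInt P)

theorem Represents.one {m : ℕ} :
    Represents (1 : Module.End ℚ (MvPolynomial (Fin m) ℚ)) 1 := fun P => by simp

theorem Represents.mul {m : ℕ} {T U : Module.End ℚ (MvPolynomial (Fin m) ℚ)}
    {a b : AddMonoidAlgebra ℚ (Fin m → ℤ)} (hT : Represents T a) (hU : Represents U b) :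
    Represents (T * U) (a * b) := fun P => by
  rw [Module.End.mul_apply, hT, hU, map_mul, Module.End.mul_apply]

theorem Represents.add {m : ℕ} {T U : Module.End ℚ (MvPolynomial (Fin m) ℚ)}
    {a b : AddMonoidAlgebra ℚ (Fin m → ℤ)} (hT : Represents T a) (hU : Represents U b) :
    Represents (T + U) (a + b) := fun P => by
  rw [map_add, LinearMap.add_apply, LinearMap.add_apply, ← hT, ← hU]
  ext k
  simp [evalInt]

theorem Represents.sub {m : ℕ} {T U : Module.End ℚ (MvPolynomial (Fin m) ℚ)}
    {a b : AddMonoidAlgebra ℚ (Fin m → ℤ)} (hT : Represents T a) (hU : Represents U b) :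
    Represents (T - U) (a - b) := fun P => by
  rw [map_sub, LinearMap.sub_apply, LinearMap.sub_apply, ← hT, ← hU]
  ext k
  simp [evalInt]

theorem represents_translateVar {m : ℕ} (i : Fin m) (c : ℤ) :
    Represents (translateVar i (c : ℚ)) (shiftElt (Pi.single i c)) := fun P => by
  ext k
  rw [shiftAction_shiftElt]
  simp only [evalInt, translateVar, AlgHom.toLinearMap_apply]
  induction P using MvPolynomial.induction_on with
  | C a => simp
  | add p q hp hq => simp only [map_add, hp, hq]
  | mul_X p l hp =>
    simp only [map_mul, hp, MvPolynomial.aeval_X, MvPolynomial.eval_X, Pi.add_apply]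
    congr 1
    by_cases h : l = i
    · subst h
      simp
    · simp [h]

theorem represents_pairOp {m : ℕ} (p q : Fin m) :
    Represents (pairOp p q) (pairElt (unitVec p) (unitVec q)) := by
  have h1 : ∀ i : Fin m, Represents (translateVar i 1) (shiftElt (unitVec i)) := fun i => by
    simpa using represents_translateVar i 1
  have h2 : ∀ i : Fin m, Represents (translateVar i (-1)) (shiftElt (-unitVec i)) := fun i => by
    simpa [unitVec, Pi.single_neg] using represents_translateVar i (-1)
  exact ((h1 p).mul (((h2 p).add (h2 q)).sub .one)).mul (((h2 p).add (h1 q)).sub .one)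

theorem represents_totalOp (m : ℕ) : Represents (totalOp m) (totalElt m) := by
  have key : ∀ (s : Finset (Fin m × Fin m)) (h : _),
      Represents (s.noncommProd (fun pq => pairOp pq.1 pq.2) h)
        (∏ pq ∈ s, pairElt (unitVec pq.1) (unitVec pq.2)) := by
    intro s
    induction s using Finset.induction_on with
    | empty => intro h; simpa using Represents.one
    | insert a s ha ih =>
      intro h
      rw [Finset.noncommProd_insert_of_notMem _ _ _ _ ha, Finset.prod_insert ha]
      exact (represents_pairOp _ _).mul (ih _)
  exact key _ _

/-! ### Symmetries of the total operator -/

/-- Precomposition with `σ` as an additive map. -/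
def precompHom {m n : ℕ} (σ : Fin m → Fin n) : (Fin n → ℤ) →+ (Fin m → ℤ) where
  toFun v := v ∘ σ
  map_zero' := rfl
  map_add' _ _ := rfl

theorem precompHom_swap_unitVec {m : ℕ} (i j p : Fin m) :
    precompHom (Equiv.swap i j) (unitVec p) = unitVec (Equiv.swap i j p) := by
  ext q
  simp only [precompHom, AddMonoidHom.coe_mk, ZeroHom.coe_mk, Function.comp, Pi.single_apply]
  congr 1
  exact propext (Equiv.swap_apply_eq_iff)

theorem swap_succ_lt {m : ℕ} {i j p q : Fin m} (hij : (j : ℕ) = i + 1) (h : p < q)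
    (hne : (p, q) ≠ (i, j)) : Equiv.swap i j p < Equiv.swap i j q := by
  have hne' : ¬ (p = i ∧ q = j) := by simpa using hne
  simp only [Equiv.swap_apply_def]
  split_ifs <;> simp only [Fin.ext_iff, Fin.lt_def] at * <;> omega

/-- An adjacent transposition reverses the order of the pair `(i, j)` only. That factor is
symmetrised by `diagElt`, and the remaining factors are permuted among themselves. -/
theorem mapDomainAlgHom_swap_diagElt_mul_totalElt {m : ℕ} (i j : Fin m)
    (hij : (j : ℕ) = i + 1) :
    AddMonoidAlgebra.mapDomainAlgHom ℚ ℚ (precompHom (Equiv.swap i j))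
        (diagElt (unitVec i) (unitVec j) * totalElt m) =
      diagElt (unitVec i) (unitVec j) * totalElt m := by
  have hmem : (i, j) ∈ ltPairs m := by
    simp only [ltPairs, Finset.mem_filter, Finset.mem_univ, true_and, Fin.lt_def]
    omega
  rw [totalElt, ← Finset.mul_prod_erase _ _ hmem, ← mul_assoc, map_mul]
  congr 1
  · simp only [map_mul, mapDomainAlgHom_pairElt, precompHom_swap_unitVec, Equiv.swap_apply_left,
      Equiv.swap_apply_right, diagElt, map_add, map_sub, map_one, mapDomainAlgHom_shiftElt]
    exact (diagElt_mul_pairElt_comm _ _).symm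
  · rw [map_prod]
    refine Finset.prod_bij' (fun pq _ => (Equiv.swap i j pq.1, Equiv.swap i j pq.2))
      (fun pq _ => (Equiv.swap i j pq.1, Equiv.swap i j pq.2)) ?_ ?_ ?_ ?_ ?_
    · rintro ⟨p, q⟩ h
      simp only [ltPairs, Finset.mem_erase, Finset.mem_filter, Finset.mem_univ, true_and] at h ⊢
      refine ⟨fun e => ?_, swap_succ_lt hij h.2 h.1⟩
      simp only [Prod.mk.injEq, Equiv.swap_apply_eq_iff, Equiv.swap_apply_left,
        Equiv.swap_apply_right] at e
      rw [e.1, e.2, Fin.lt_def] at h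
      omega
    · rintro ⟨p, q⟩ h
      simp only [ltPairs, Finset.mem_erase, Finset.mem_filter, Finset.mem_univ, true_and] at h ⊢
      refine ⟨fun e => ?_, swap_succ_lt hij h.2 h.1⟩
      simp only [Prod.mk.injEq, Equiv.swap_apply_eq_iff, Equiv.swap_apply_left,
        Equiv.swap_apply_right] at e
      rw [e.1, e.2, Fin.lt_def] at h
      omega
    · simp
    · simp
    · rintro ⟨p, q⟩ h
      simp only [mapDomainAlgHom_pairElt, precompHom_swap_unitVec]

/-- `f` changes sign under transpositions of the coordinates. -/
def IsAlternating {m : ℕ} (f : (Fin m → ℤ) → ℚ) : Prop :=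
  ∀ i j : Fin m, i ≠ j → ∀ k, f (k ∘ Equiv.swap i j) = - f k

/-- `J(c + 1, c + 1) - J(c, c + 1) + J(c, c) = 0` for neighbouring coordinates. -/
def VanishesOnDiagonals {m : ℕ} (J : (Fin m → ℤ) → ℚ) : Prop :=
  ∀ i j : Fin m, (j : ℕ) = i + 1 → ∀ k : Fin m → ℤ, k i = k j →
    J (k + unitVec i + unitVec j) - J (k + unitVec j) + J k = 0

/-- The operator `diagElt * totalElt` is fixed by the swap while `f` changes sign, so at a point
with `k i = k j` the value equals its own negative. -/
theorem IsAlternating.vanishesOnDiagonals {m : ℕ} {f : (Fin m → ℤ) → ℚ}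
    (hf : IsAlternating f) : VanishesOnDiagonals (shiftAction _ (totalElt m) f) := by
  intro i j hij k hk
  have hne : i ≠ j := by
    intro h
    rw [h] at hij
    omega
  have hk' : k ∘ Equiv.swap i j = k := by
    ext q
    simp only [Function.comp, Equiv.swap_apply_def]
    split_ifs with h1 h2
    · rw [h1, hk]
    · rw [h2, hk]
    · rfl
  have h := shiftAction_comp (precompHom (Equiv.swap i j)) (fun t => t ∘ Equiv.swap i j)
    (fun _ _ => rfl) (diagElt (unitVec i) (unitVec j) * totalElt m) f k
  rw [mapDomainAlgHom_swap_diagElt_mul_totalElt i j hij, hk',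
    show (fun t : Fin m → ℤ => f (t ∘ Equiv.swap i j)) = - f from funext (hf i j hne),
    map_neg, Pi.neg_apply] at h
  have h0 : shiftAction _ (diagElt (unitVec i) (unitVec j) * totalElt m) f k = 0 := by linarith
  rw [map_mul, Module.End.mul_apply] at h0
  simp only [diagElt, map_add, map_sub, map_one, map_mul, LinearMap.add_apply,
    LinearMap.sub_apply, Pi.add_apply, Pi.sub_apply, Module.End.one_apply, Module.End.mul_apply,
    shiftAction_shiftElt] at h0
  linarith

/-! ### Reflection of the last coordinate -/

/-- Negation of the last coordinate. -/
def negLast (m : ℕ) : (Fin (m + 1) → ℤ) →+ (Fin (m + 1) → ℤ) where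
  toFun v := Function.update v (Fin.last m) (-v (Fin.last m))
  map_zero' := by simp
  map_add' v w := by
    ext i
    by_cases h : i = Fin.last m
    · subst h
      simp [add_comm]
    · simp [h]

theorem negLast_unitVec_last (m : ℕ) : negLast m (unitVec (Fin.last m)) = -unitVec (Fin.last m) := by
  ext i
  by_cases h : i = Fin.last m
  · subst h
    simp [negLast]
  · simp [negLast, h]

theorem negLast_unitVec_of_ne {m : ℕ} {i : Fin (m + 1)} (hi : i ≠ Fin.last m) :
    negLast m (unitVec i) = unitVec i := by
  simp [negLast, hi]

/-- The last index occurs only as the second member of a pair, where `pairElt` does not distinguish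
a shift from its inverse. -/
theorem mapDomainAlgHom_negLast_totalElt (m : ℕ) :
    AddMonoidAlgebra.mapDomainAlgHom ℚ ℚ (negLast m) (totalElt (m + 1)) = totalElt (m + 1) := by
  rw [totalElt, map_prod]
  refine Finset.prod_congr rfl fun pq h => ?_
  have hlt : pq.1 < pq.2 := by simpa [ltPairs] using h
  rw [mapDomainAlgHom_pairElt, negLast_unitVec_of_ne (hlt.trans_le (Fin.le_last _)).ne]
  by_cases hq : pq.2 = Fin.last m
  · rw [hq, negLast_unitVec_last, pairElt_neg_right]
  · rw [negLast_unitVec_of_ne hq]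

/-- If `f` is odd about `c` in its last coordinate, then so is `shiftAction (totalElt _) f`, which
therefore vanishes when the last coordinate is `c`. -/
theorem shiftAction_totalElt_eq_zero_of_odd_last {m : ℕ} (c : ℤ) (f : (Fin (m + 1) → ℤ) → ℚ)
    (hf : ∀ k, f (Function.update k (Fin.last m) (2 * c - k (Fin.last m))) = - f k)
    (k : Fin (m + 1) → ℤ) (hk : k (Fin.last m) = c) :
    shiftAction _ (totalElt (m + 1)) f k = 0 := by
  have h := shiftAction_comp (negLast m)
    (fun t => Function.update t (Fin.last m) (2 * c - t (Fin.last m))) (fun t v => by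
      ext i
      by_cases h : i = Fin.last m
      · subst h
        simp [negLast]
        ring
      · simp [negLast, h]) (totalElt (m + 1)) f k
  rw [mapDomainAlgHom_negLast_totalElt, show (fun t : Fin (m + 1) → ℤ =>
    f (Function.update t (Fin.last m) (2 * c - t (Fin.last m)))) = - f from funext hf, map_neg,
    Pi.neg_apply, show Function.update k (Fin.last m) (2 * c - k (Fin.last m)) = k by
      rw [Function.update_eq_self_iff]; omega] at h
  linarith

/-! ### Deletion of a coordinate -/

theorem precompHom_succAbove_unitVec_self {m : ℕ} (j : Fin (m + 1)) :
    precompHom j.succAbove (unitVec j) = 0 := by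
  ext i
  simp [precompHom]

theorem precompHom_succAbove_unitVec {m : ℕ} (j : Fin (m + 1)) (i : Fin m) :
    precompHom j.succAbove (unitVec (j.succAbove i)) = unitVec i := by
  ext l
  simp [precompHom, Pi.single_apply]

/-- Deleting the `j`-th coordinate from the total operator leaves a shift by `-1` in the
coordinates before `j`. -/
theorem mapDomainAlgHom_succAbove_totalElt {m : ℕ} (j : Fin (m + 1)) :
    AddMonoidAlgebra.mapDomainAlgHom ℚ ℚ (precompHom j.succAbove) (totalElt (m + 1)) =
      shiftElt (fun i : Fin m => if i.castSucc < j then -1 else 0) * totalElt m := by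
  rw [totalElt, map_prod]
  simp only [mapDomainAlgHom_pairElt]
  rw [prod_ltPairs (fun p q => pairElt (precompHom j.succAbove (unitVec p))
    (precompHom j.succAbove (unitVec q))), totalElt,
    prod_ltPairs (fun p q : Fin m => pairElt (unitVec p) (unitVec q)),
    Fin.prod_univ_succAbove _ j]
  have h1 : (∏ q, if j < q then pairElt (precompHom j.succAbove (unitVec j))
      (precompHom j.succAbove (unitVec q)) else 1) = 1 := by
    refine Finset.prod_eq_one fun q _ => ?_
    rw [precompHom_succAbove_unitVec_self, pairElt_zero_left, ite_self]
  rw [h1, one_mul]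
  simp only [Fin.prod_univ_succAbove _ j, precompHom_succAbove_unitVec_self,
    precompHom_succAbove_unitVec, pairElt_zero_right, Fin.succAbove_lt_succAbove_iff,
    Finset.prod_mul_distrib]
  congr 1
  -- Each pair `(i, j)` with `i` before `j` leaves one factor `E_i⁻¹`; these combine into a single
  -- shift.
  have h2 : ∀ s : Finset (Fin m), shiftElt (∑ i ∈ s, if j.succAbove i < j then -unitVec i else 0) =
      ∏ i ∈ s, if j.succAbove i < j then shiftElt (-unitVec i) else 1 := by
    intro s
    induction s using Finset.induction_on with
    | empty => simp [shiftElt_zero]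
    | insert a s ha ih =>
      rw [Finset.sum_insert ha, Finset.prod_insert ha, shiftElt_add, ih]
      split_ifs <;> simp [shiftElt_zero]
  rw [← h2]
  congr 1
  ext i
  rw [Finset.sum_apply, Finset.sum_eq_single i]
  · simp only [Fin.succAbove_lt_iff_castSucc_lt]
    split_ifs <;> simp
  · intro b _ hb
    split_ifs <;> simp [hb.symm]
  · simp

/-! ### Summation over strict interlacing rows -/

/-- The strictly increasing rows `l` with `k 0 ≤ l 0 ≤ k 1 ≤ l 1 ≤ ⋯`. -/
noncomputable def interlacing {m : ℕ} (k : Fin (m + 1) → ℤ) : Finset (Fin m → ℤ) :=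
  (Fintype.piFinset fun i => Finset.Icc (k i.castSucc) (k i.succ)).filter StrictMono

theorem mem_interlacing {m : ℕ} {k : Fin (m + 1) → ℤ} {l : Fin m → ℤ} :
    l ∈ interlacing k ↔ (∀ i, k i.castSucc ≤ l i ∧ l i ≤ k i.succ) ∧ StrictMono l := by
  simp [interlacing]

/-- Strictness constrains the entry after `c` beyond its interval only when `c = k 1`, where it
raises the lower bound to `k 1 + 1`. -/
theorem cons_mem_interlacing {m : ℕ} {k : Fin (m + 2) → ℤ} {c : ℤ} {t : Fin m → ℤ} :
    (Fin.cons c t : Fin (m + 1) → ℤ) ∈ interlacing k ↔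
      c ∈ Finset.Icc (k 0) (k 1) ∧
        t ∈ interlacing
          (Function.update (Fin.tail k) 0 (if c = k 1 then k 1 + 1 else k 1)) := by
  cases m with
  | zero =>
    simp [mem_interlacing, StrictMono]
  | succ m =>
    have hs : StrictMono (Fin.cons c t : Fin (m + 2) → ℤ) ↔ c < t 0 ∧ StrictMono t :=
      strictMono_vecCons
    have h1 : (Fin.cons c t : Fin (m + 2) → ℤ) 1 = t 0 := rfl
    have h2 : k (Fin.castSucc 1) = k 1 := rfl
    rw [mem_interlacing, mem_interlacing, hs, Fin.forall_fin_succ, Fin.forall_fin_succ,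
      Fin.forall_fin_succ (P := fun i : Fin (m + 1) => _ ≤ t i ∧ t i ≤ _)]
    simp only [Fin.castSucc_zero, Fin.cons_zero, Fin.cons_succ, Fin.succ_zero_eq_one, h1, h2,
      Function.update_self, Finset.mem_Icc, Fin.tail, ← Fin.succ_castSucc,
      Function.update_of_ne (Fin.succ_ne_zero _)]
    constructor
    · rintro ⟨⟨h0, h1, h2⟩, h3, h4⟩
      refine ⟨h0, ⟨⟨?_, h1.2⟩, h2⟩, h4⟩
      split_ifs <;> omega
    · rintro ⟨h0, ⟨⟨h1, h2⟩, h3⟩, h4⟩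
      have h5 : k 1 ≤ t 0 ∧ c < t 0 := by
        split_ifs at h1 <;> omega
      exact ⟨⟨h0, ⟨h5.1, h2⟩, h3⟩, h5.2, h4⟩

theorem sum_interlacing {m : ℕ} (k : Fin (m + 2) → ℤ) (f : (Fin (m + 1) → ℤ) → ℚ) :
    ∑ l ∈ interlacing k, f l = ∑ c ∈ Finset.Icc (k 0) (k 1),
      ∑ t ∈ interlacing (Function.update (Fin.tail k) 0 (if c = k 1 then k 1 + 1 else k 1)),
        f (Fin.cons c t) := by
  rw [Finset.sum_sigma']
  refine Finset.sum_bij' (fun l _ => ⟨l 0, Fin.tail l⟩) (fun ct _ => Fin.cons ct.1 ct.2)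
    ?_ ?_ ?_ ?_ ?_
  · intro l hl
    rw [← Fin.cons_self_tail l, cons_mem_interlacing] at hl
    exact Finset.mem_sigma.2 hl
  · intro ct h
    exact cons_mem_interlacing.2 (Finset.mem_sigma.1 h)
  · intro l _
    exact Fin.cons_self_tail l
  · rintro ⟨c, t⟩ _
    simp
  · intro l _
    rw [Fin.cons_self_tail]

theorem sum_Ico_int_sub (g : ℤ → ℚ) {a b : ℤ} (h : a ≤ b) :
    ∑ c ∈ Finset.Ico a b, (g (c + 1) - g c) = g b - g a := by
  induction b, h using Int.leInduction with
  | base => simp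
  | succ b hb ih =>
    rw [show Finset.Ico a (b + 1) = insert b (Finset.Ico a b) by ext; simp; omega,
      Finset.sum_insert (by simp), ih]
    ring

/-! ### Mixed differences and telescoping -/

/-- The group algebra element representing the product of all forward differences. -/
noncomputable def diffElt (m : ℕ) : AddMonoidAlgebra ℚ (Fin m → ℤ) :=
  ∏ i, (shiftElt (unitVec i) - 1)

/-- Prepending `0` as an additive map. -/
def consZeroHom (m : ℕ) : (Fin m → ℤ) →+ (Fin (m + 1) → ℤ) where
  toFun v := Fin.cons 0 v
  map_zero' := by
    ext i
    cases i using Fin.cases <;> rfl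
  map_add' v w := by
    ext i
    cases i using Fin.cases <;> rfl

theorem consZeroHom_unitVec {m : ℕ} (i : Fin m) : consZeroHom m (unitVec i) = unitVec i.succ := by
  ext j
  cases j using Fin.cases with
  | zero => simp [consZeroHom]
  | succ j => simp [consZeroHom, Pi.single_apply]

theorem cons_add_consZeroHom {m : ℕ} (c : ℤ) (t v : Fin m → ℤ) :
    (Fin.cons c (t + v) : Fin (m + 1) → ℤ) = Fin.cons c t + consZeroHom m v := by
  ext j
  cases j using Fin.cases <;> simp [consZeroHom]

theorem cons_add_unitVec_succ {m : ℕ} (c : ℤ) (t : Fin m → ℤ) (i : Fin m) :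
    (Fin.cons c t : Fin (m + 1) → ℤ) + unitVec i.succ = Fin.cons c (t + unitVec i) := by
  rw [cons_add_consZeroHom, consZeroHom_unitVec]

theorem cons_add_unitVec_zero {m : ℕ} (c : ℤ) (t : Fin m → ℤ) :
    (Fin.cons c t : Fin (m + 1) → ℤ) + unitVec 0 = Fin.cons (c + 1) t := by
  ext j
  cases j using Fin.cases <;> simp

theorem shiftAction_diffElt_cons {m : ℕ} (J : (Fin (m + 1) → ℤ) → ℚ) (c : ℤ) (t : Fin m → ℤ) :
    shiftAction _ (diffElt (m + 1)) J (Fin.cons c t) =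
      shiftAction _ (diffElt m) (fun s => J (Fin.cons (c + 1) s)) t -
        shiftAction _ (diffElt m) (fun s => J (Fin.cons c s)) t := by
  have h : AddMonoidAlgebra.mapDomainAlgHom ℚ ℚ (consZeroHom m) (diffElt m) =
      ∏ i : Fin m, (shiftElt (unitVec i.succ) - 1) := by
    simp only [diffElt, map_prod, map_sub, map_one, mapDomainAlgHom_shiftElt, consZeroHom_unitVec]
  rw [shiftAction_comp (consZeroHom m) (fun s => Fin.cons (c + 1) s) (cons_add_consZeroHom _),
    shiftAction_comp (consZeroHom m) (fun s => Fin.cons c s) (cons_add_consZeroHom _), h,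
    diffElt, Fin.prod_univ_succ, map_mul, Module.End.mul_apply, map_sub, map_one,
    LinearMap.sub_apply, Pi.sub_apply, Module.End.one_apply, shiftAction_shiftElt,
    cons_add_unitVec_zero]

/-- The alternating sum over the ways to skip an entry of `k`, the entries after the skipped one
being raised by `1`. -/
def altSum {m : ℕ} (J : (Fin m → ℤ) → ℚ) (k : Fin (m + 1) → ℤ) : ℚ :=
  ∑ j : Fin (m + 1), (-1) ^ (j : ℕ) *
    J (fun i => if i.castSucc < j then k i.castSucc else k i.succ + 1)

theorem altSum_succ {m : ℕ} (J : (Fin (m + 1) → ℤ) → ℚ) (k : Fin (m + 2) → ℤ) :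
    altSum J k = J (fun i => k i.succ + 1) -
      altSum (fun t => J (Fin.cons (k 0) t)) (Fin.tail k) := by
  rw [altSum, Fin.sum_univ_succ, altSum, sub_eq_add_neg, ← Finset.sum_neg_distrib]
  congr 1
  · simp
  · refine Finset.sum_congr rfl fun j _ => ?_
    rw [Fin.val_succ, pow_succ, mul_neg_one, neg_mul]
    congr 3
    ext i
    cases i using Fin.cases with
    | zero => simp
    | succ i => simp [Fin.tail]

theorem VanishesOnDiagonals.cons {m : ℕ} {J : (Fin (m + 1) → ℤ) → ℚ} (hJ : VanishesOnDiagonals J)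
    (c : ℤ) : VanishesOnDiagonals fun t : Fin m → ℤ => J (Fin.cons c t) := by
  intro i j hij k hk
  have h := hJ i.succ j.succ (by simp [hij]) (Fin.cons c k) (by simpa using hk)
  simpa only [cons_add_unitVec_succ] using h

/-- The inequalities between consecutive entries under which `sum_interlacing_diff` holds. -/
def Admissible {m : ℕ} (k : Fin (m + 1) → ℤ) : Prop :=
  -- The first gap is only weak because the recursion raises the first entry by one. The last gap is
  -- only weak because the appended bound `x` may equal the entry before it.
  ∀ i : Fin m, k i.castSucc + (if (i : ℕ) = 0 then 0 else 1) ≤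
    k i.succ + (if (i : ℕ) + 1 = m then 1 else 0)

theorem Admissible.update_tail {m : ℕ} {k : Fin (m + 3) → ℤ} (hk : Admissible k) {c : ℤ}
    (hc : c ≤ k 1 + 1) : Admissible (Function.update (Fin.tail k) 0 c) := by
  intro i
  have h := hk i.succ
  have e : (i.succ : Fin (m + 2)).castSucc = i.castSucc.succ := rfl
  rw [Function.update_of_ne (Fin.succ_ne_zero _), Fin.tail]
  cases i using Fin.cases with
  | zero =>
    have h' : k 1 + 1 ≤ k (Fin.succ (Fin.succ 0)) + (if 1 + 1 = m + 2 then 1 else 0) := h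
    have e' : (if 1 + 1 = m + 2 then (1 : ℤ) else 0) = if 0 + 1 = m + 1 then 1 else 0 := by
      simp
    rw [Fin.castSucc_zero, Function.update_self, Fin.val_zero, if_pos rfl]
    omega
  | succ i =>
    rw [Function.update_of_ne (by simp), Fin.tail]
    rw [e] at h
    simp only [Fin.val_succ] at h ⊢
    split_ifs at h ⊢ <;> omega

/-- Induction on the first entry `c` of the row. The values `c < k 1` telescope; for `c = k 1`
strictness alters the range of the next entry, and the resulting defect is the diagonal relation. -/
theorem sum_interlacing_diff {m : ℕ} (J : (Fin m → ℤ) → ℚ) (hJ : VanishesOnDiagonals J)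
    (k : Fin (m + 1) → ℤ) (hk : Admissible k) :
    ∑ l ∈ interlacing k, shiftAction _ (diffElt m) J l = altSum J k := by
  induction m with
  | zero =>
    have h : interlacing k = {0} := by
      ext l
      simp [mem_interlacing, StrictMono, Subsingleton.elim l 0]
    rw [h, Finset.sum_singleton, diffElt, altSum]
    simp only [Finset.univ_eq_empty, Finset.prod_empty, map_one, Module.End.one_apply]
    simp
    congr 1
    exact Subsingleton.elim _ _
  | succ m ih =>
    have hcons : ∀ c (u : Fin (m + 1) → ℤ), Admissible u →
        ∑ t ∈ interlacing u, shiftAction _ (diffElt (m + 1)) J (Fin.cons c t) =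
          altSum (fun t => J (Fin.cons (c + 1) t)) u - altSum (fun t => J (Fin.cons c t)) u := by
      intro c u hu
      simp only [shiftAction_diffElt_cons, Finset.sum_sub_distrib]
      rw [ih _ (hJ.cons _) _ hu, ih _ (hJ.cons _) _ hu]
    rw [sum_interlacing, altSum_succ]
    cases m with
    | zero =>
      have hadm : ∀ u : Fin 1 → ℤ, Admissible u := fun u i => i.elim0
      have halt : ∀ (f : (Fin 0 → ℤ) → ℚ) (u : Fin 1 → ℤ), altSum f u = f 0 := by
        intro f u
        rw [altSum, Fin.sum_univ_one, Fin.val_zero, pow_zero, one_mul]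
        exact congrArg f (Subsingleton.elim _ _)
      -- Equality is allowed: the interval is then empty and the telescoped difference is zero.
      have hle : k 0 ≤ k 1 + 1 := by
        have := hk 0
        simp at this
        omega
      simp only [hcons _ _ (hadm _), halt]
      rw [show Finset.Icc (k 0) (k 1) = Finset.Ico (k 0) (k 1 + 1) by ext; simp,
        sum_Ico_int_sub (fun c => J (Fin.cons c 0)) hle]
      congr 2
      ext i
      fin_cases i
      rfl
    | succ m =>
      have hle : k 0 ≤ k 1 := by
        have := hk 0
        simpa using this
      rw [show Finset.Icc (k 0) (k 1) = insert (k 1) (Finset.Ico (k 0) (k 1)) by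
        ext; simp; omega, Finset.sum_insert (by simp)]
      have h1 : ∑ c ∈ Finset.Ico (k 0) (k 1), ∑ t ∈ interlacing
          (Function.update (Fin.tail k) 0 (if c = k 1 then k 1 + 1 else k 1)),
          shiftAction _ (diffElt (m + 2)) J (Fin.cons c t) =
          altSum (fun t => J (Fin.cons (k 1) t)) (Fin.tail k) -
            altSum (fun t => J (Fin.cons (k 0) t)) (Fin.tail k) := by
        rw [← sum_Ico_int_sub (fun c => altSum (fun t => J (Fin.cons c t)) (Fin.tail k)) hle]
        refine Finset.sum_congr rfl fun c hc => ?_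
        have hu : Function.update (Fin.tail k) 0 (k 1) = Fin.tail k :=
          Function.update_eq_self 0 (Fin.tail k)
        have hadm := hk.update_tail (c := k 1) (by omega)
        rw [hu] at hadm
        rw [if_neg (by simp at hc; omega), hu, hcons _ _ hadm]
      have htail : ∀ c, Fin.tail (Function.update (Fin.tail k) 0 c) = Fin.tail (Fin.tail k) := by
        intro c
        ext i
        simp [Fin.tail]
      have hsucc : ∀ c, (fun i : Fin (m + 1) => Function.update (Fin.tail k) 0 c i.succ + 1) =
          fun i => Fin.tail k i.succ + 1 := by
        intro c
        ext i
        simp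
      have hdiag : ∀ (c : ℤ) (u : Fin (m + 1) → ℤ),
          altSum (fun t => J (Fin.cons (c + 1) (Fin.cons (c + 1) t))) u -
            altSum (fun t => J (Fin.cons c (Fin.cons (c + 1) t))) u +
            altSum (fun t => J (Fin.cons c (Fin.cons c t))) u = 0 := by
        intro c u
        simp only [altSum, ← Finset.sum_sub_distrib, ← Finset.sum_add_distrib, ← mul_sub,
          ← mul_add]
        refine Finset.sum_eq_zero fun j _ => ?_
        have h := fun t => hJ 0 1 rfl (Fin.cons c (Fin.cons c t)) rfl
        have e1 : (1 : Fin (m + 2)) = Fin.succ 0 := rfl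
        simp only [cons_add_unitVec_zero, e1, cons_add_unitVec_succ] at h
        rw [h, mul_zero]
      rw [h1, if_pos rfl, hcons _ _ (hk.update_tail le_rfl)]
      simp only [altSum_succ _ (Function.update (Fin.tail k) 0 (k 1 + 1)), htail, hsucc,
        Function.update_self]
      have e0 : Fin.tail k 0 = k 1 := rfl
      rw [altSum_succ (fun t => J (Fin.cons (k 1) t)) (Fin.tail k), e0]
      have hfin : (fun i : Fin (m + 2) => k i.succ + 1) =
          Fin.cons (k 1 + 1) (fun i => Fin.tail k i.succ + 1) := by
        ext i
        cases i using Fin.cases <;> rfl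
      rw [hfin]
      -- After expansion, the terms left over are the combination in `hdiag` at `c = k 1`.
      linarith [hdiag (k 1) (Fin.tail (Fin.tail k))]

/-! ### Determinantal families -/

/-- The determinant `det (g a (l b))`. -/
noncomputable def rowDet (g : ℕ → ℤ → ℚ) (m : ℕ) (l : Fin m → ℤ) : ℚ :=
  (Matrix.of fun a b : Fin m => g a (l b)).det

theorem isAlternating_rowDet (g : ℕ → ℤ → ℚ) (m : ℕ) : IsAlternating (rowDet g m) := by
  intro i j hij k
  have h := Matrix.det_permute' (Equiv.swap i j) (Matrix.of fun a b : Fin m => g a (k b))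
  rw [Equiv.Perm.sign_swap hij] at h
  simpa [rowDet, Matrix.submatrix] using h

theorem rowDet_succ_of_zero_eq_one {g : ℕ → ℤ → ℚ} (hg : ∀ c, g 0 c = 1) (m : ℕ)
    (k : Fin (m + 1) → ℤ) :
    rowDet g (m + 1) k =
      ∑ j : Fin (m + 1), (-1) ^ (j : ℕ) * rowDet (fun a => g (a + 1)) m (k ∘ j.succAbove) := by
  rw [rowDet, Matrix.det_succ_row_zero]
  refine Finset.sum_congr rfl fun j _ => ?_
  simp [hg, rowDet, Matrix.submatrix]

theorem shiftAction_diffElt_prod {m : ℕ} (f : Fin m → ℤ → ℚ) (l : Fin m → ℤ) :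
    shiftAction _ (diffElt m) (fun l => ∏ b, f b (l b)) l =
      ∏ b, (f b (l b + 1) - f b (l b)) := by
  induction m with
  | zero => simp [diffElt]
  | succ m ih =>
    rw [← Fin.cons_self_tail l, shiftAction_diffElt_cons]
    have h : ∀ c, shiftAction _ (diffElt m)
        (fun s : Fin m → ℤ => ∏ b, f b ((Fin.cons c s : Fin (m + 1) → ℤ) b)) (Fin.tail l) =
        f 0 c * ∏ b : Fin m, (f b.succ (Fin.tail l b + 1) - f b.succ (Fin.tail l b)) := by
      intro c
      rw [← ih (fun b => f b.succ), ← smul_eq_mul, ← Pi.smul_apply, ← map_smul]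
      refine congrFun (congrArg _ (funext fun s => ?_)) _
      simp [Fin.prod_univ_succ]
    rw [h, h, Fin.prod_univ_succ]
    simp only [Fin.cons_zero, Fin.cons_succ]
    ring

theorem shiftAction_diffElt_rowDet {g h : ℕ → ℤ → ℚ} (hgh : ∀ a c, h a (c + 1) - h a c = g a c)
    (m : ℕ) : shiftAction _ (diffElt m) (rowDet h m) = rowDet g m := by
  ext l
  have e : rowDet h m = ∑ σ : Equiv.Perm (Fin m),
      ((Equiv.Perm.sign σ : ℤ) : ℚ) • fun l : Fin m → ℤ => ∏ b, h (σ b) (l b) := by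
    ext l
    simp [rowDet, Matrix.det_apply']
  rw [e, map_sum, Finset.sum_apply, rowDet, Matrix.det_apply']
  refine Finset.sum_congr rfl fun σ _ => ?_
  rw [map_smul, Pi.smul_apply, shiftAction_diffElt_prod (fun b => h (σ b)), smul_eq_mul]
  simp [hgh]

/-- The total operator commutes with the mixed difference, so antidifferences of the row functions
give one of the whole summand. -/
theorem sum_interlacing_rowDet {g h : ℕ → ℤ → ℚ} (hgh : ∀ a c, h a (c + 1) - h a c = g a c)
    {m : ℕ} {k : Fin (m + 1) → ℤ} (hk : Admissible k) :
    ∑ l ∈ interlacing k, shiftAction _ (totalElt m) (rowDet g m) l =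
      altSum (shiftAction _ (totalElt m) (rowDet h m)) k := by
  rw [← sum_interlacing_diff _ (isAlternating_rowDet h m).vanishesOnDiagonals k hk,
    ← shiftAction_diffElt_rowDet hgh]
  refine Finset.sum_congr rfl fun l _ => ?_
  rw [← Module.End.mul_apply, ← Module.End.mul_apply, ← map_mul, ← map_mul, mul_comm]

theorem StrictMono.admissible {m : ℕ} {k : Fin (m + 1) → ℤ} (hk : StrictMono k) :
    Admissible k := by
  intro i
  have := hk i.castSucc_lt_succ
  split_ifs <;> omega

theorem admissible_snoc {m : ℕ} {k : Fin (m + 1) → ℤ} (hk : StrictMono k) {x : ℤ}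
    (hx : k (Fin.last m) ≤ x) : Admissible (Fin.snoc k x : Fin (m + 2) → ℤ) := by
  intro i
  cases i using Fin.lastCases with
  | last =>
    simp only [Fin.snoc_castSucc, Fin.succ_last, Fin.snoc_last, Fin.val_last]
    split_ifs <;> omega
  | cast i =>
    have := hk i.castSucc_lt_succ
    rw [Fin.snoc_castSucc, Fin.succ_castSucc, Fin.snoc_castSucc]
    split_ifs <;> omega

/-- Summation over the rows above a row with one more entry. -/
theorem sum_interlacing_rowDet_of_backward_diff {g h : ℕ → ℤ → ℚ} (hg : ∀ c, g 0 c = 1)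
    (hgh : ∀ a c, g (a + 1) c - g (a + 1) (c - 1) = h a c) {m : ℕ} {k : Fin (m + 1) → ℤ}
    (hk : StrictMono k) :
    ∑ l ∈ interlacing k, shiftAction _ (totalElt m) (rowDet h m) l =
      shiftAction _ (totalElt (m + 1)) (rowDet g (m + 1)) k := by
  rw [sum_interlacing_rowDet (h := fun a c => g (a + 1) (c - 1))
    (fun a c => by rw [add_sub_cancel_right, hgh]) hk.admissible]
  -- The argument `c - 1` converts "raised after the skipped entry" in `altSum` into "lowered before
  -- it", which is the shift left by deleting a coordinate from the total operator.
  have e1 : rowDet (fun a c => g (a + 1) (c - 1)) m =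
      shiftAction _ (shiftElt fun _ => -1) (rowDet (fun a => g (a + 1)) m) := by
    ext l
    rw [shiftAction_shiftElt]
    rfl
  have e2 : rowDet g (m + 1) = ∑ j : Fin (m + 1), ((-1) ^ (j : ℕ) : ℚ) •
      fun k : Fin (m + 1) → ℤ => rowDet (fun a => g (a + 1)) m (k ∘ j.succAbove) := by
    ext k
    simp [rowDet_succ_of_zero_eq_one hg]
  rw [e1, e2, map_sum, Finset.sum_apply, altSum]
  refine Finset.sum_congr rfl fun j _ => ?_
  rw [map_smul, Pi.smul_apply, smul_eq_mul,
    shiftAction_comp (precompHom j.succAbove) (fun k => k ∘ j.succAbove) (fun _ _ => rfl),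
    mapDomainAlgHom_succAbove_totalElt, map_mul, Module.End.mul_apply, shiftAction_shiftElt,
    ← Module.End.mul_apply, ← map_mul, mul_comm (totalElt m), map_mul, Module.End.mul_apply,
    shiftAction_shiftElt]
  refine congrArg _ (congrArg _ (funext fun i => ?_))
  simp only [Pi.add_apply, Function.comp, Fin.succAbove]
  split_ifs <;> ring

theorem rowDet_update_last {h : ℕ → ℤ → ℚ} {c : ℤ} (hh : ∀ a t, h a (2 * c - t) = -h a t)
    (m : ℕ) (k : Fin (m + 1) → ℤ) :
    rowDet h (m + 1) (Function.update k (Fin.last m) (2 * c - k (Fin.last m))) =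
      -rowDet h (m + 1) k := by
  have e := Matrix.det_updateCol_smul (Matrix.of fun a b : Fin (m + 1) => h a (k b)) (Fin.last m)
    (-1) (fun a => h a (k (Fin.last m)))
  have e2 : (Matrix.of fun a b : Fin (m + 1) => h a (k b)).updateCol (Fin.last m)
      (fun a => h a (k (Fin.last m))) = Matrix.of fun a b : Fin (m + 1) => h a (k b) :=
    Matrix.updateCol_eq_self _ _
  rw [e2, neg_one_mul] at e
  rw [rowDet, rowDet, ← e]
  congr 1
  ext a b
  by_cases hb : b = Fin.last m
  · subst hb
    simp [hh]
  · simp [hb]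

/-- Summation over the rows above a row with equally many entries, bounded by `x`. -/
theorem sum_interlacing_snoc_rowDet {g h : ℕ → ℤ → ℚ} {x : ℤ}
    (hgh : ∀ a c, h a c - h a (c + 1) = g a c) (hh : ∀ a c, h a (2 * (x + 1) - c) = -h a c)
    {m : ℕ} {k : Fin (m + 1) → ℤ} (hk : StrictMono k) (hx : k (Fin.last m) ≤ x) :
    ∑ l ∈ interlacing (Fin.snoc k x : Fin (m + 2) → ℤ),
        shiftAction _ (totalElt (m + 1)) (rowDet g (m + 1)) l =
      shiftAction _ (totalElt (m + 1)) (rowDet h (m + 1)) k := by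
  rw [sum_interlacing_rowDet (h := fun a c => -h a c) (fun a c => by rw [← hgh]; ring)
    (admissible_snoc hk hx), altSum, Fin.sum_univ_castSucc, Finset.sum_eq_zero, zero_add]
  · have e : rowDet (fun a c => -h a c) (m + 1) = ((-1) ^ (m + 1) : ℚ) • rowDet h (m + 1) := by
      ext l
      have := Matrix.det_neg (Matrix.of fun a b : Fin (m + 1) => h a (l b))
      rw [Fintype.card_fin] at this
      exact this
    rw [e, map_smul, Pi.smul_apply, smul_eq_mul, ← mul_assoc, Fin.val_last, ← mul_pow]
    simp [Fin.castSucc_lt_last]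
  · intro j _
    -- Skipping any entry other than `x` leaves `x + 1` in the last place, the centre of the
    -- reflection.
    rw [shiftAction_totalElt_eq_zero_of_odd_last (x + 1), mul_zero]
    · exact rowDet_update_last (fun a c => by rw [hh]) m
    · have hj : ¬ (Fin.last m).castSucc < j.castSucc := by simp [Fin.le_last]
      simp [hj]

/-- Pulling row and column factors out of a Vandermonde-type determinant. -/
theorem det_prod_add (m : ℕ) (u y : Fin m → ℚ) (r : ℕ → ℚ) (d : ℕ → ℚ) :
    (Matrix.of fun a b : Fin m => u b * ((∏ i ∈ Finset.range a, (y b + r i)) * d a)).det =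
      (∏ ij ∈ ltPairs m, (y ij.2 - y ij.1)) * (∏ b, u b) * ∏ a : Fin m, d a := by
  have h1 := Matrix.det_mul_row u (Matrix.of fun a b : Fin m =>
    d a * (∏ i ∈ Finset.range a, (y b + r i)))
  have h2 := Matrix.det_mul_column (fun a : Fin m => d a) (Matrix.of fun a b : Fin m =>
    ∏ i ∈ Finset.range a, (y b + r i))
  simp only [Matrix.of_apply] at h1 h2
  -- Row `a` holds the values at the `y b` of a monic polynomial of degree `a`.
  have h3 := Matrix.det_eval_matrixOfPolynomials_eq_det_vandermonde y
    (fun a : Fin m => ∏ i ∈ Finset.range a, (Polynomial.X + Polynomial.C (r i)))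
    (fun a => by
      rw [Polynomial.natDegree_prod_of_monic _ _ fun i _ => Polynomial.monic_X_add_C _]
      simp)
    (fun a => Polynomial.monic_prod_of_monic _ _ fun i _ => Polynomial.monic_X_add_C _)
  have h4 : (Matrix.of fun a b : Fin m => ∏ i ∈ Finset.range a, (y b + r i)).det =
      ∏ ij ∈ ltPairs m, (y ij.2 - y ij.1) := by
    rw [prod_ltPairs (fun i j => y j - y i), ← Matrix.det_transpose]
    simp only [Polynomial.eval_prod, Polynomial.eval_add, Polynomial.eval_X,
      Polynomial.eval_C] at h3
    rw [Matrix.det_vandermonde] at h3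
    simp only [← Finset.prod_filter]
    refine Eq.trans h3.symm ?_
    refine Finset.prod_congr rfl fun i _ => Finset.prod_congr ?_ fun _ _ => rfl
    rw [Finset.filter_lt_eq_Ioi]
  rw [← h4, mul_right_comm, mul_comm, mul_comm (Matrix.det _), ← h2, ← h1]
  simp only [mul_comm (d _)]

/-! ### The row functions -/

/-- The falling product `s (s - 1) ⋯ (s - n + 1)`. -/
def fallingProd (s : ℚ) (n : ℕ) : ℚ := ∏ i ∈ Finset.range n, (s - i)

theorem fallingProd_succ (s : ℚ) (n : ℕ) :
    fallingProd s (n + 1) = fallingProd s n * (s - n) := Finset.prod_range_succ _ _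

theorem fallingProd_add_one_succ (s : ℚ) (n : ℕ) :
    fallingProd (s + 1) (n + 1) = (s + 1) * fallingProd s n := by
  rw [fallingProd, Finset.prod_range_succ', fallingProd, mul_comm]
  simp

theorem fallingProd_add_one_sub (s : ℚ) (n : ℕ) :
    fallingProd (s + 1) (n + 1) - fallingProd s (n + 1) = (n + 1) * fallingProd s n := by
  rw [fallingProd_succ s, fallingProd_add_one_succ]
  ring

/-- The row functions for an odd number of rows, up to sign binomial coefficients. -/
def oddRow (x : ℤ) (a : ℕ) (c : ℤ) : ℚ :=
  (-1) ^ a * fallingProd (c - x + a - 1) (2 * a) / (2 * a).factorial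

/-- The row functions for an even number of rows, up to sign binomial coefficients. -/
def evenRow (x : ℤ) (a : ℕ) (c : ℤ) : ℚ :=
  (-1) ^ (a + 1) * fallingProd (c - x + a - 1) (2 * a + 1) / (2 * a + 1).factorial

theorem oddRow_zero (x c : ℤ) : oddRow x 0 c = 1 := by
  simp [oddRow, fallingProd]

/-- Pascal's rule. With `oddRow_succ_sub` it links the two families in the alternation that the row
recursions require. -/
theorem evenRow_sub_add_one (x : ℤ) (a : ℕ) (c : ℤ) :
    evenRow x a c - evenRow x a (c + 1) = oddRow x a c := by
  have h := fallingProd_add_one_sub (c - x + a - 1) (2 * a)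
  have e : ((c + 1 : ℤ) : ℚ) - x + a - 1 = c - x + a - 1 + 1 := by push_cast; ring
  have hf : ((2 * a).factorial : ℚ) ≠ 0 := by positivity
  rw [evenRow, evenRow, oddRow, e, Nat.factorial_succ, pow_succ]
  push_cast at h ⊢
  field_simp
  linear_combination h

theorem oddRow_succ_sub (x : ℤ) (a : ℕ) (c : ℤ) :
    oddRow x (a + 1) c - oddRow x (a + 1) (c - 1) = evenRow x a c := by
  have h := fallingProd_add_one_sub (c - x + a - 1) (2 * a + 1)
  have e : ((c - 1 : ℤ) : ℚ) - x + (a + 1 : ℕ) - 1 = c - x + a - 1 := by push_cast; ring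
  have e2 : (c : ℚ) - x + (a + 1 : ℕ) - 1 = c - x + a - 1 + 1 := by push_cast; ring
  have hf : ((2 * a + 1).factorial : ℚ) ≠ 0 := by positivity
  rw [evenRow, oddRow, oddRow, e, e2, show 2 * (a + 1) = 2 * a + 1 + 1 by ring,
    Nat.factorial_succ (2 * a + 1)]
  push_cast at h ⊢
  field_simp
  linear_combination h

/-- The factors pair off around their midpoint: with `s = c - x`, `(s + i) (s - 1 - i) = s (s - 1) -
i (i + 1)`. -/
theorem oddRow_eq_prod (x : ℤ) (a : ℕ) (c : ℤ) :
    oddRow x a c = 1 * ((∏ i ∈ Finset.range a, ((c - x) * (x + 1 - c) + (i * (i + 1) : ℚ))) *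
      (1 / (2 * a).factorial)) := by
  have h : (-1) ^ a * fallingProd (c - x + a - 1) (2 * a) =
      ∏ i ∈ Finset.range a, ((c - x) * (x + 1 - c) + (i * (i + 1) : ℚ)) := by
    induction a with
    | zero => simp [fallingProd]
    | succ a ih =>
      rw [Finset.prod_range_succ, ← ih, show 2 * (a + 1) = 2 * a + 1 + 1 by ring,
        show (c : ℚ) - x + (a + 1 : ℕ) - 1 = c - x + a - 1 + 1 by push_cast; ring,
        fallingProd_add_one_succ, fallingProd_succ]
      push_cast
      ring
  rw [oddRow, h]
  ring

/-- The same pairing, now about `c = x + 1`, leaves the middle factor unpaired. -/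
theorem evenRow_eq_prod (x : ℤ) (a : ℕ) (c : ℤ) :
    evenRow x a c = (x + 1 - c) * ((∏ i ∈ Finset.range a, (-(c - x - 1) ^ 2 + (i + 1 : ℚ) ^ 2)) *
      (1 / (2 * a + 1).factorial)) := by
  have h : (-1) ^ (a + 1) * fallingProd (c - x + a - 1) (2 * a + 1) =
      (x + 1 - c) * ∏ i ∈ Finset.range a, (-(c - x - 1) ^ 2 + (i + 1 : ℚ) ^ 2) := by
    induction a with
    | zero =>
      simp [fallingProd]
      ring
    | succ a ih =>
      rw [Finset.prod_range_succ, ← mul_assoc, ← ih,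
        show 2 * (a + 1) + 1 = 2 * a + 1 + 1 + 1 by ring,
        show (c : ℚ) - x + (a + 1 : ℕ) - 1 = c - x + a - 1 + 1 by push_cast; ring,
        fallingProd_add_one_succ, fallingProd_succ]
      push_cast
      ring
  rw [evenRow, h]
  ring

theorem evenRow_reflect (x : ℤ) (a : ℕ) (c : ℤ) :
    evenRow x a (2 * (x + 1) - c) = -evenRow x a c := by
  rw [evenRow_eq_prod, evenRow_eq_prod,
    show ((2 * (x + 1) - c : ℤ) : ℚ) - x - 1 = -(c - x - 1) by push_cast; ring, neg_sq]
  push_cast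
  ring

/-! ### The product formulas as determinants -/

theorem prod_ltPairs_eq_prod_range {m : ℕ} (f : ℕ → ℕ → ℚ) :
    ∏ ij ∈ ltPairs m, f ij.1 ij.2 = ∏ j : Fin m, ∏ i ∈ Finset.range j, f i j := by
  rw [prod_ltPairs (fun i j : Fin m => f i j), Finset.prod_comm]
  refine Finset.prod_congr rfl fun j _ => ?_
  rw [← Finset.prod_filter]
  refine Finset.prod_bij (fun i _ => (i : ℕ)) ?_ ?_ ?_ ?_
  · intro i hi
    exact Finset.mem_range.2 (Finset.mem_filter.1 hi).2
  · intro i _ i' _ h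
    exact Fin.ext h
  · intro i hi
    have := Finset.mem_range.1 hi
    exact ⟨⟨i, by omega⟩, Finset.mem_filter.2 ⟨Finset.mem_univ _, this⟩, rfl⟩
  · intro i _
    rfl

theorem prod_range_sub (j : ℕ) : ∏ i ∈ Finset.range j, ((j : ℚ) - i) = j.factorial := by
  rw [← Finset.prod_range_reflect, ← Finset.prod_range_add_one_eq_factorial]
  push_cast
  refine Finset.prod_congr rfl fun i hi => ?_
  have := Finset.mem_range.1 hi
  rw [Nat.cast_sub (by omega), Nat.cast_sub (by omega)]
  push_cast
  ring

/-- The product is `j!` times `(j + 1) ⋯ (2j)`; the indices are zero-based, hence `j + i + 1` for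
the `j + i - 1` of the formula. -/
theorem prod_range_odd_denominator (j : ℕ) :
    ∏ i ∈ Finset.range j, (((j : ℚ) - i) * (j + i + 1)) = (2 * j).factorial := by
  rw [Finset.prod_mul_distrib, prod_range_sub, two_mul, ← Nat.factorial_mul_ascFactorial,
    Nat.ascFactorial_eq_prod_range]
  push_cast
  congr 1
  exact Finset.prod_congr rfl fun i _ => by ring

theorem prod_range_even_denominator (j : ℕ) :
    (∏ i ∈ Finset.range j, (((j : ℚ) - i) * (j + i + 2))) * (j + 1) = (2 * j + 1).factorial := by
  rw [Finset.prod_mul_distrib, prod_range_sub, show 2 * j + 1 = j + 1 + j by ring,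
    ← Nat.factorial_mul_ascFactorial, Nat.ascFactorial_eq_prod_range, Nat.factorial_succ]
  push_cast
  rw [Finset.prod_congr rfl fun (i : ℕ) _ => show (j : ℚ) + i + 2 = j + 1 + 1 + i by ring]
  ring

theorem evalInt_oddPoly (m : ℕ) (x : ℤ) : evalInt (oddPoly m x) = rowDet (oddRow x) m := by
  ext k
  have hd : ∏ ij ∈ ltPairs m,
      (1 / ((oneBased ij.2 - oneBased ij.1) * (oneBased ij.2 + oneBased ij.1 - 1))) =
      ∏ a : Fin m, (1 / ((2 * (a : ℕ)).factorial : ℚ)) := by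
    simp only [← prod_range_odd_denominator, Finset.prod_div_distrib, Finset.prod_const_one]
    rw [← prod_ltPairs_eq_prod_range (fun i j => ((j : ℚ) - i) * (j + i + 1))]
    congr 1
    refine Finset.prod_congr rfl fun ij _ => ?_
    simp only [oneBased]
    ring
  rw [rowDet]
  simp only [oddRow_eq_prod]
  rw [det_prod_add m (fun _ => 1) (fun b => ((k b : ℚ) - x) * (x + 1 - k b))
    (fun i => i * (i + 1)) (fun a => 1 / (2 * a).factorial), ← hd]
  simp only [evalInt, oddPoly, map_prod, map_mul, map_sub, MvPolynomial.eval_X,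
    MvPolynomial.eval_C, Finset.prod_mul_distrib, Finset.prod_const_one, mul_one]
  rw [← Finset.prod_mul_distrib]
  congr 1
  exact Finset.prod_congr rfl fun ij _ => by ring

theorem evalInt_evenPoly (m : ℕ) (x : ℤ) : evalInt (evenPoly m x) = rowDet (evenRow x) m := by
  ext k
  have hd : (∏ ij ∈ ltPairs m,
      (1 / ((oneBased ij.2 - oneBased ij.1) * (oneBased ij.2 + oneBased ij.1)))) *
      ∏ i : Fin m, (1 / oneBased i) =
      ∏ a : Fin m, (1 / ((2 * (a : ℕ) + 1).factorial : ℚ)) := by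
    simp only [← prod_range_even_denominator, Finset.prod_div_distrib, Finset.prod_const_one,
      Finset.prod_mul_distrib (f := fun a : Fin m => ∏ i ∈ Finset.range a, _)]
    rw [← prod_ltPairs_eq_prod_range (fun i j => ((j : ℚ) - i) * (j + i + 2)),
      div_mul_div_comm, one_mul]
    congr 2
    refine Finset.prod_congr rfl fun ij _ => ?_
    simp only [oneBased]
    ring
  rw [rowDet]
  simp only [evenRow_eq_prod]
  rw [det_prod_add m (fun b => (x : ℚ) + 1 - k b) (fun b => -((k b : ℚ) - x - 1) ^ 2)
    (fun i => (i + 1) ^ 2) (fun a => 1 / (2 * a + 1).factorial), ← hd]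
  simp only [evalInt, evenPoly, map_prod, map_mul, map_sub, MvPolynomial.eval_X,
    MvPolynomial.eval_C, Finset.prod_mul_distrib]
  rw [mul_mul_mul_comm]
  rw [← Finset.prod_mul_distrib]
  congr 2
  exact Finset.prod_congr rfl fun ij _ => by ring

/-! ### Removing the bottom row -/

theorem HalvedIndex.bounds {n : ℕ} (s : HalvedIndex n) :
    1 ≤ s.row ∧ s.row ≤ n ∧ 1 ≤ s.col ∧ s.col ≤ (s.row + 1) / 2 :=
  ⟨s.2.1.1, s.2.1.2, s.2.2⟩

/-- A position, viewed in an array with one more row. -/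
def HalvedIndex.castSucc {n : ℕ} (s : HalvedIndex n) : HalvedIndex (n + 1) :=
  ⟨s.1, ⟨s.2.1.1, s.2.1.2.trans n.le_succ⟩, s.2.2⟩

/-- The position in row `n` with zero-based column `j`. -/
def HalvedIndex.bottom {n : ℕ} (j : Fin ((n + 1) / 2)) : HalvedIndex n :=
  ⟨(n, j + 1), ⟨by have := j.2; omega, le_rfl⟩, by omega, by have := j.2; simp only; omega⟩

theorem HalvedIndex.row_eq_or {n : ℕ} (s : HalvedIndex (n + 1)) :
    (∃ t : HalvedIndex n, t.castSucc = s) ∨ s.row = n + 1 := by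
  by_cases h : s.row ≤ n
  · exact Or.inl ⟨⟨s.1, ⟨s.2.1.1, h⟩, s.2.2⟩, rfl⟩
  · exact Or.inr (by have := s.bounds; omega)

theorem bottom_eq_of_mem {n : ℕ} {x : ℤ} {k : Fin ((n + 1) / 2) → ℤ} {a : HalvedIndex n → ℤ}
    (ha : a ∈ halvedMonotoneTriangles n x k) (j : Fin ((n + 1) / 2)) :
    a (HalvedIndex.bottom j) = k j := ha.2.2 j _ rfl rfl

theorem strictMono_of_mem {n : ℕ} {x : ℤ} {k : Fin ((n + 1) / 2) → ℤ} {a : HalvedIndex n → ℤ}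
    (ha : a ∈ halvedMonotoneTriangles n x k) : StrictMono k := by
  have key : ∀ d : ℕ, ∀ i j : Fin ((n + 1) / 2), (j : ℕ) = i + d + 1 → k i < k j := by
    intro d
    induction d with
    | zero =>
      intro i j hij
      rw [← bottom_eq_of_mem ha, ← bottom_eq_of_mem ha]
      exact ha.1.strict_row _ _ rfl (by simp [HalvedIndex.bottom, hij])
    | succ d ih =>
      intro i j hij
      have hj := j.2
      refine (ih i ⟨i + d + 1, by omega⟩ rfl).trans ?_
      rw [← bottom_eq_of_mem ha, ← bottom_eq_of_mem ha]
      exact ha.1.strict_row _ _ rfl (show (j : ℕ) + 1 = i + d + 1 + 1 + 1 by omega)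
  intro i j hij
  exact key (j - i - 1) i j (by rw [Fin.lt_def] at hij; omega)

/-- The rows that may stand above the row `k`. -/
def IsRowAbove {r r' : ℕ} (x : ℤ) (k : Fin r' → ℤ) (l : Fin r → ℤ) : Prop :=
  StrictMono l ∧ (∀ i, l i ≤ x) ∧ (∀ (i : Fin r) (i' : Fin r'), (i' : ℕ) = i → k i' ≤ l i) ∧
    ∀ (i : Fin r) (i' : Fin r'), (i' : ℕ) = i + 1 → l i ≤ k i'

/-- The deleted row is prescribed by `k`, so truncation loses nothing. -/
theorem injOn_truncate {n : ℕ} {x : ℤ} {k : Fin ((n + 1 + 1) / 2) → ℤ} :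
    Set.InjOn (fun (a : HalvedIndex (n + 1) → ℤ) (s : HalvedIndex n) => a s.castSucc)
      (halvedMonotoneTriangles (n + 1) x k) := by
  intro a ha b hb hab
  ext s
  obtain ⟨t, rfl⟩ | hs := s.row_eq_or
  · exact congrFun hab t
  · have hb' := s.bounds
    have hcol : s.col - 1 < (n + 1 + 1) / 2 := by
      rw [hs] at hb'
      omega
    have hcol' : s.col = s.col - 1 + 1 := by omega
    rw [ha.2.2 ⟨s.col - 1, hcol⟩ s hs hcol', hb.2.2 ⟨s.col - 1, hcol⟩ s hs hcol']

theorem truncate_image {n : ℕ} {x : ℤ} {k : Fin ((n + 1 + 1) / 2) → ℤ} (hk : StrictMono k)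
    (hkx : ∀ i, k i ≤ x) :
    (fun (a : HalvedIndex (n + 1) → ℤ) (s : HalvedIndex n) => a s.castSucc) ''
        halvedMonotoneTriangles (n + 1) x k =
      ⋃ l ∈ {l : Fin ((n + 1) / 2) → ℤ | IsRowAbove x k l}, halvedMonotoneTriangles n x l := by
  ext b
  simp only [Set.mem_image, Set.mem_iUnion, Set.mem_ofPred_eq, exists_prop]
  constructor
  · rintro ⟨a, ha, rfl⟩
    have hmem : (fun s : HalvedIndex n => a s.castSucc) ∈
        halvedMonotoneTriangles n x fun j => a (HalvedIndex.bottom j).castSucc := by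
      refine ⟨⟨fun s t h1 h2 => ha.1.northeast _ _ h1 h2, fun s t h1 h2 => ha.1.southeast _ _ h1 h2,
        fun s t h1 h2 => ha.1.strict_row _ _ h1 h2⟩, fun s => ha.2.1 _, fun j s h1 h2 => ?_⟩
      exact congrArg a (Subtype.ext (Prod.ext h1 h2))
    refine ⟨_, ⟨strictMono_of_mem hmem, fun i => ha.2.1 _, fun i i' h => ?_, fun i i' h => ?_⟩,
      hmem⟩
    · rw [← bottom_eq_of_mem ha]
      exact ha.1.northeast _ _ rfl (by simp [HalvedIndex.bottom, HalvedIndex.castSucc, h])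
    · rw [← bottom_eq_of_mem ha]
      exact ha.1.southeast _ _ rfl (by simp [HalvedIndex.bottom, HalvedIndex.castSucc, h])
  · rintro ⟨l, ⟨_, _, hl1, hl2⟩, hb⟩
    have hcol : ∀ s : HalvedIndex (n + 1), ¬ s.row ≤ n → s.col - 1 < (n + 1 + 1) / 2 := by
      intro s hs
      have h := s.bounds
      rw [show s.row = n + 1 by omega] at h
      omega
    let a : HalvedIndex (n + 1) → ℤ := fun s =>
      if h : s.row ≤ n then b ⟨s.1, ⟨s.2.1.1, h⟩, s.2.2⟩ else k ⟨s.col - 1, hcol s h⟩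
    have a_pos : ∀ (s : HalvedIndex (n + 1)) (h : s.row ≤ n),
        a s = b ⟨s.1, ⟨s.2.1.1, h⟩, s.2.2⟩ := fun s h => dif_pos h
    have a_neg : ∀ (s : HalvedIndex (n + 1)) (h : ¬ s.row ≤ n),
        a s = k ⟨s.col - 1, hcol s h⟩ := fun s h => dif_neg h
    have a_row : ∀ (s : HalvedIndex (n + 1)) (h : s.row = n) (hc : s.col - 1 < (n + 1) / 2),
        a s = l ⟨s.col - 1, hc⟩ := by
      intro s h hc
      rw [a_pos s h.le]
      exact hb.2.2 _ _ h (show s.col = s.col - 1 + 1 by have := s.bounds; omega)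
    have hc : ∀ s : HalvedIndex (n + 1), s.row = n → s.col - 1 < (n + 1) / 2 := by
      intro s h
      have h' := s.bounds
      rw [h] at h'
      omega
    refine ⟨a, ⟨⟨?_, ?_, ?_⟩, ?_, ?_⟩, ?_⟩
    · intro s t h1 h2
      by_cases ht : t.row ≤ n
      · rw [a_pos t ht, a_pos s (by omega)]
        exact hb.1.northeast _ _ h1 h2
      · have hs : s.row = n := by have := t.bounds; omega
        rw [a_neg t ht, a_row s hs (hc s hs)]
        exact hl1 _ _ (show t.col - 1 = s.col - 1 by rw [h2])
    · intro s t h1 h2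
      by_cases ht : t.row ≤ n
      · rw [a_pos t ht, a_pos s (by omega)]
        exact hb.1.southeast _ _ h1 h2
      · have hs : s.row = n := by have := t.bounds; omega
        rw [a_neg t ht, a_row s hs (hc s hs)]
        exact hl2 _ _ (show t.col - 1 = s.col - 1 + 1 by have := s.bounds; omega)
    · intro s t h1 h2
      by_cases ht : t.row ≤ n
      · rw [a_pos t ht, a_pos s (by omega)]
        exact hb.1.strict_row _ _ h1 h2
      · rw [a_neg t ht, a_neg s (by omega)]
        exact hk (show s.col - 1 < t.col - 1 by have := s.bounds; omega)
    · intro s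
      by_cases hs : s.row ≤ n
      · rw [a_pos s hs]
        exact hb.2.1 _
      · rw [a_neg s hs]
        exact hkx _
    · intro j s h1 h2
      rw [a_neg s (by omega)]
      exact congrArg k (Fin.ext (show s.col - 1 = j by omega))
    · ext s
      exact a_pos s.castSucc s.2.1.2

theorem ncard_biUnion_finset {ι α : Type*} (L : Finset ι) (T : ι → Set α)
    (hfin : ∀ l ∈ L, (T l).Finite) (hdisj : ∀ l ∈ L, ∀ l' ∈ L, l ≠ l' → Disjoint (T l) (T l')) :
    (⋃ l ∈ L, T l).ncard = ∑ l ∈ L, (T l).ncard := by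
  classical
  induction L using Finset.induction_on with
  | empty => simp
  | insert a s ha ih =>
    have hs : ∀ l ∈ s, (T l).Finite := fun l hl => hfin l (Finset.mem_insert_of_mem hl)
    have hfs : (⋃ l ∈ s, T l).Finite := s.finite_toSet.biUnion hs
    rw [Finset.set_biUnion_insert, Finset.sum_insert ha, Set.ncard_union_eq ?_
      (hfin a (Finset.mem_insert_self _ _)) hfs, ih hs]
    · exact fun l hl l' hl' =>
        hdisj l (Finset.mem_insert_of_mem hl) l' (Finset.mem_insert_of_mem hl')
    · simp only [Set.disjoint_iUnion_right]
      exact fun l hl => hdisj a (Finset.mem_insert_self _ _) l (Finset.mem_insert_of_mem hl)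
        (fun h => ha (h ▸ hl))

theorem ncard_halvedMonotoneTriangles_succ {n r r' : ℕ} (e : (n + 1) / 2 = r)
    (e' : (n + 1 + 1) / 2 = r') {x : ℤ} {k : Fin r' → ℤ} (hk : StrictMono k)
    (hkx : ∀ i, k i ≤ x) (L : Finset (Fin r → ℤ)) (hL : ∀ l, l ∈ L ↔ IsRowAbove x k l)
    (hfin : ∀ l ∈ L, (halvedMonotoneTriangles n x (l ∘ Fin.cast e)).Finite) :
    (halvedMonotoneTriangles (n + 1) x (k ∘ Fin.cast e')).Finite ∧
      (halvedMonotoneTriangles (n + 1) x (k ∘ Fin.cast e')).ncard =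
        ∑ l ∈ L, (halvedMonotoneTriangles n x (l ∘ Fin.cast e)).ncard := by
  subst e e'
  have himg := truncate_image hk hkx
  have hset : {l : Fin ((n + 1) / 2) → ℤ | IsRowAbove x k l} = L := by
    ext l
    exact (hL l).symm
  rw [hset] at himg
  refine ⟨Set.Finite.of_finite_image ?_ injOn_truncate, ?_⟩
  · exact himg ▸ L.finite_toSet.biUnion hfin
  · refine injOn_truncate.ncard_image.symm.trans ?_
    refine (congrArg Set.ncard himg).trans ?_
    refine ncard_biUnion_finset L _ hfin fun l _ l' _ hne => Set.disjoint_left.2 fun b hb hb' => ?_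
    exact hne (funext fun j => (bottom_eq_of_mem hb j).symm.trans (bottom_eq_of_mem hb' j))

theorem mem_interlacing_iff_isRowAbove {m : ℕ} {x : ℤ} {k : Fin (m + 1) → ℤ}
    (hkx : ∀ i, k i ≤ x) (l : Fin m → ℤ) : l ∈ interlacing k ↔ IsRowAbove x k l := by
  rw [mem_interlacing]
  constructor
  · rintro ⟨h1, h2⟩
    refine ⟨h2, fun i => (h1 i).2.trans (hkx _), fun i i' h => ?_, fun i i' h => ?_⟩
    · rw [show i' = i.castSucc from Fin.ext h]
      exact (h1 i).1
    · rw [show i' = i.succ from Fin.ext h]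
      exact (h1 i).2
  · rintro ⟨h1, _, h2, h3⟩
    exact ⟨fun i => ⟨h2 _ _ rfl, h3 _ _ rfl⟩, h1⟩

/-- Appending `x` to `k` turns the bound on the last entry into one more interlacing condition. -/
theorem mem_interlacing_snoc_iff_isRowAbove {m : ℕ} {x : ℤ} {k : Fin (m + 1) → ℤ}
    (hkx : ∀ i, k i ≤ x) (l : Fin (m + 1) → ℤ) :
    l ∈ interlacing (Fin.snoc k x : Fin (m + 2) → ℤ) ↔ IsRowAbove x k l := by
  rw [mem_interlacing]
  simp only [Fin.snoc_castSucc]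
  constructor
  · rintro ⟨h1, h2⟩
    refine ⟨h2, fun i => (h1 i).2.trans ?_, fun i i' h => ?_, fun i i' h => ?_⟩
    · cases i using Fin.lastCases with
      | last => simp
      | cast i => rw [Fin.succ_castSucc, Fin.snoc_castSucc]; exact hkx _
    · rw [Fin.ext h]
      exact (h1 i).1
    · have h' := (h1 i).2
      rwa [show i.succ = i'.castSucc from Fin.ext h.symm, Fin.snoc_castSucc] at h'
  · rintro ⟨h1, h2, h3, h4⟩
    refine ⟨fun i => ⟨h3 _ _ rfl, ?_⟩, h1⟩
    cases i using Fin.lastCases with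
    | last => simpa using h2 _
    | cast i =>
      rw [Fin.succ_castSucc, Fin.snoc_castSucc]
      exact h4 _ _ rfl

/-! ### Induction on the number of rows -/

theorem card_halvedMonotoneTriangles (x : ℤ) (n r : ℕ) (e : (n + 1) / 2 = r) (k : Fin r → ℤ)
    (hk : StrictMono k) (hkx : ∀ i, k i ≤ x) :
    (halvedMonotoneTriangles n x (k ∘ Fin.cast e)).Finite ∧
      ((halvedMonotoneTriangles n x (k ∘ Fin.cast e)).ncard : ℚ) =
        shiftAction _ (totalElt r)
          (rowDet (if n % 2 = 1 then oddRow x else evenRow x) r) k := by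
  induction n generalizing r with
  | zero =>
    subst e
    -- The empty triangle counts once and the empty determinant is `1`; starting here makes the
    -- one-row case an instance of the induction step.
    have hempty : IsEmpty (HalvedIndex 0) := ⟨fun s => by have := s.2.1; omega⟩
    have huniv : halvedMonotoneTriangles 0 x (k ∘ Fin.cast rfl) = Set.univ :=
      Set.eq_univ_of_forall fun a => ⟨⟨fun s => hempty.elim s, fun s => hempty.elim s,
        fun s => hempty.elim s⟩, fun s => hempty.elim s, fun _ s => hempty.elim s⟩
    rw [huniv]
    refine ⟨Set.finite_univ, ?_⟩
    rw [Set.ncard_univ, Nat.card_unique]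
    have h1 : totalElt 0 = 1 := by simp [totalElt, ltPairs]
    have h2 : ∀ g, rowDet g 0 k = 1 := fun g => Matrix.det_fin_zero
    change ((1 : ℕ) : ℚ) = shiftAction _ (totalElt 0) _ k
    rw [h1, map_one, Module.End.one_apply, h2, Nat.cast_one]
  | succ n ih =>
    obtain ⟨m, rfl⟩ : ∃ m, r = m + 1 := ⟨r - 1, by omega⟩
    rcases Nat.mod_two_eq_zero_or_one n with hn | hn
    -- An odd number `n + 1` of rows: the row above is one entry shorter.
    · have hrow := mem_interlacing_iff_isRowAbove hkx
      have e0 : (n + 1) / 2 = m := by omega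
      have hl := fun l hl => ih m e0 l ((hrow l).1 hl).1 ((hrow l).1 hl).2.1
      obtain ⟨hf, hc⟩ := ncard_halvedMonotoneTriangles_succ e0 e hk hkx _ hrow
        fun l h => (hl l h).1
      refine ⟨hf, ?_⟩
      rw [hc, Nat.cast_sum, Finset.sum_congr rfl fun l h => (hl l h).2, if_neg (by omega),
        if_pos (by omega), sum_interlacing_rowDet_of_backward_diff (oddRow_zero x)
          (oddRow_succ_sub x) hk]
    -- An even number `n + 1` of rows: the row above is equally long and bounded by `x`.
    · have hrow := mem_interlacing_snoc_iff_isRowAbove hkx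
      have e0 : (n + 1) / 2 = m + 1 := by omega
      have hl := fun l hl => ih (m + 1) e0 l ((hrow l).1 hl).1 ((hrow l).1 hl).2.1
      obtain ⟨hf, hc⟩ := ncard_halvedMonotoneTriangles_succ e0 e hk hkx _ hrow
        fun l h => (hl l h).1
      refine ⟨hf, ?_⟩
      rw [hc, Nat.cast_sum, Finset.sum_congr rfl fun l h => (hl l h).2, if_pos hn,
        if_neg (by omega), sum_interlacing_snoc_rowDet (evenRow_sub_add_one x)
          (evenRow_reflect x) hk (hkx _)]

theorem theorem1 (n : ℕ) (hn : 1 ≤ n) (x : ℤ) (k : Fin ((n + 1) / 2) → ℤ)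
    (hk : StrictMono k) (hkx : ∀ i, k i ≤ x) :
    (halvedMonotoneTriangles n x k).Finite ∧
    (Odd n → ((halvedMonotoneTriangles n x k).ncard : ℚ) =
      MvPolynomial.eval (fun i => (k i : ℚ)) (totalOp ((n + 1) / 2) (oddPoly ((n + 1) / 2) x))) ∧
    (Even n → ((halvedMonotoneTriangles n x k).ncard : ℚ) =
      MvPolynomial.eval (fun i => (k i : ℚ)) (totalOp ((n + 1) / 2) (evenPoly ((n + 1) / 2) x))) := by
  obtain ⟨hf, hc⟩ := card_halvedMonotoneTriangles x n _ rfl k hk hkx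
  have hrep := fun P => congrFun (represents_totalOp ((n + 1) / 2) P) k
  refine ⟨hf, fun ho => ?_, fun he => ?_⟩
  · refine hc.trans (Eq.trans ?_ (hrep _).symm)
    rw [if_pos (Nat.odd_iff.1 ho), evalInt_oddPoly]
  · refine hc.trans (Eq.trans ?_ (hrep _).symm)
    rw [if_neg (by have := Nat.even_iff.1 he; omega), evalInt_evenPoly]
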